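/- Let $f\colon\mathbb R^n\times\mathbb R^m\to\mathbb R$, $g_i\colon\mathbb R^n\times\mathbb R^m\to\mathbb R$ ($i\in I$) and $h_j\colon\mathbb R^n\times\mathbb R^m\to\mathbb R$ ($j\in J$) be continuously differentiable, where $I,J$ are finite (possibly empty) index sets. For $x\in\mathbb R^n$ put $$\Gamma(x):=\{y\in\mathbb R^m\mid g_i(x,y)\le 0\ (i\in I),\ h_j(x,y)=0\ (j\in J)\},$$ $$S(x):=\operatorname{argmin}_y\{f(x,y)\mid y\in\Gamma(x)\},\qquad \varphi(x):=\inf_y\{f(x,y)\mid y\in\Gamma(x)\}\in[-\infty,\infty],$$ and let $g_0(x,y):=f(x,y)-\varphi(x)$, so that $S(x)=\{y\mid g_i(x,y)\le 0\ (i\in\{0\}\cup I),\ h_j(x,y)=0\ (j\in J)\}$. For a set-valued mapping $\Upsilon$, $\operatorname{dom}\Upsilon:=\{x\mid\Upsilon(x)\ne\varnothing\}$. A pair of finite families of vectors $\bigl((a^i)_{i\in I_1},(b^j)_{j\in I_2}\bigr)$ is called positive-linearly dependent if there are scalars $\alpha_i\ge 0$ ($i\in I_1$) and $\beta_j\in\mathbb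 R$ ($j\in I_2$), not all zero, with $\sum_i\alpha_ia^i+\sum_j\beta_jb^j=0$. Fix $\bar x\in\operatorname{dom}\Gamma$ and assume: 1. for each $x\in\mathbb R^n$, the functions $f(x,\cdot)$ and $g_i(x,\cdot)$ ($i\in I$) are convex, and the functions $h_j(x,\cdot)$ ($j\in J$) are affine; 2. $\Gamma$ is locally bounded at $\bar x$: there are a bounded set $M\subset\mathbb R^m$ and a neighborhood $V$ of $\bar x$ such that $\Gamma(x)\subset M$ for all $x\in V$; 3. for each $\bar y\in S(\bar x)$, the relaxed constant positive linear dependence constraint qualification for the above description of $S$ by $(g_i)_{i\in\{0\}\cup I}$ and $(h_j)_{j\in J}$ holds at $(\bar x,\bar y)$ with respect to $\operatorname{dom}\Gamma$, i.e., there are a neighborhood $U$ of $(\bar x,\bar y)$ and a set $B\subset J$ such that * the family $(\nabla_yh_j(\bar x,\bar y))_{j\in B}$ is a basis of the span of $\{\nabla_yh_j(\bar x,\bar y)\mid j\in J\}$; * the family $(\nabla_yh_j(x,y))_{j\in J}$ has constant rank on $U\cap(\operatorname{dom}\Gamma\times\mathbb R^m)$; * for each $K\subset\{0\}\cup\{i\in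 I\mid g_i(\bar x,\bar y)=0\}$ such that the pair $\bigl((\nabla_yg_i(\bar x,\bar y))_{i\in K},(\nabla_yh_j(\bar x,\bar y))_{j\in B}\bigr)$ is positive-linearly dependent, the vectors $\nabla_yg_i(x,y)$ ($i\in K$) and $\nabla_yh_j(x,y)$ ($j\in B$) together form a linearly dependent family for each $(x,y)\in U\cap(\operatorname{dom}\Gamma\times\mathbb R^m)$. (Here $\nabla_yg_0=\nabla_yf$ wherever $\varphi(x)$ is finite, which by assumption 2 is the case for all $x\in\operatorname{dom}\Gamma$ near $\bar x$.) Then the solution mapping $S$ is lower semicontinuous at $\bar x$ with respect to $\operatorname{dom}S$: for each open set $O\subset\mathbb R^m$ with $S(\bar x)\cap O\ne\varnothing$ there is a neighborhood $W$ of $\bar x$ such that $S(x)\cap O\neq\varnothing$ for all $x\in W\cap\operatorname{dom}S$. -/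

import Mathlib

open scoped Topology

noncomputable section

namespace ParamOpt

/-- The Euclidean space `ℝⁿ`. -/
abbrev E (n : ℕ) : Type := EuclideanSpace ℝ (Fin n)

variable {n m : ℕ}

/-- The domain of a set-valued mapping. -/
def dom (Υ : E n → Set (E m)) : Set (E n) := {x | (Υ x).Nonempty}

/-- Local boundedness of a set-valued mapping at `xbar`. -/
def LocallyBoundedAt (Υ : E n → Set (E m)) (xbar : E n) : Prop :=
  ∃ B : Set (E m), Bornology.IsBounded B ∧ ∃ U ∈ 𝓝 xbar, ∀ x ∈ U, Υ x ⊆ B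

/-- Positive-linear dependence of a pair of finite families of vectors: the coefficients of the
first family are nonnegative, those of the second family are free. -/
def PosLinDep {ι κ V : Type*} [Fintype ι] [Fintype κ] [AddCommGroup V] [Module ℝ V]
    (a : ι → V) (b : κ → V) : Prop :=
  ∃ (α : ι → ℝ) (β : κ → ℝ), (∀ i, 0 ≤ α i) ∧ ((∃ i, α i ≠ 0) ∨ ∃ j, β j ≠ 0) ∧
    ∑ i, α i • a i + ∑ j, β j • b j = 0

/-- The partial gradient `∇_y c(x, y)` of an extended real-valued function. Where `c(x, ·)` is
finite around `y`, this is the usual gradient. -/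
def gradY (c : E n → E m → EReal) (x : E n) (y : E m) : E m :=
  gradient (fun y' => (c x y').toReal) y

/-- The relaxed constant positive linear dependence constraint qualification at `(xbar, ybar)`
w.r.t. `Ω` for the parametric constraint system
`c i (x, y) ≤ 0` (`i : ι`), `e j (x, y) = 0` (`j : κ`). -/
def RCPLDAt {ι κ : Type*} [Fintype ι] [Fintype κ]
    (c : ι → E n → E m → EReal) (e : κ → E n → E m → EReal)
    (Ω : Set (E n)) (xbar : E n) (ybar : E m) : Prop :=
  ∃ U ∈ 𝓝 (xbar, ybar), ∃ B : Finset κ,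
    -- the gradients indexed by `B` form a basis of the span of the equality gradients
    (LinearIndependent ℝ (fun j : B => gradY (e j) xbar ybar) ∧
      Submodule.span ℝ (Set.range fun j : B => gradY (e j) xbar ybar) =
        Submodule.span ℝ (Set.range fun j : κ => gradY (e j) xbar ybar)) ∧
    -- the equality gradients have constant rank
    (∃ r : ℕ, ∀ x y, (x, y) ∈ U → x ∈ Ω →
      Module.finrank ℝ (Submodule.span ℝ (Set.range fun j : κ => gradY (e j) x y)) = r) ∧
    -- positive-linear dependence at the reference point persists as linear dependence
    (∀ K : Finset ι, (∀ i ∈ K, c i xbar ybar = 0) →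
      PosLinDep (fun i : K => gradY (c i) xbar ybar) (fun j : B => gradY (e j) xbar ybar) →
      ∀ x y, (x, y) ∈ U → x ∈ Ω →
        ¬ LinearIndependent ℝ
          (Sum.elim (fun i : K => gradY (c i) x y) (fun j : B => gradY (e j) x y)))

/-- The feasible set mapping `Γ` with inequality constraints `g i (x, y) ≤ 0` and equality
constraints `h j (x, y) = 0`. -/
def feasibleMap {ℓ q : ℕ} (g : Fin ℓ → E n → E m → ℝ) (h : Fin q → E n → E m → ℝ) :
    E n → Set (E m) :=
  fun x => {y | (∀ i, g i x y ≤ 0) ∧ ∀ j, h j x y = 0}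

/-- The solution mapping `S` of `min_y {f(x, y) | y ∈ Γ(x)}`. -/
def solutionMap (f : E n → E m → ℝ) (Γ : E n → Set (E m)) : E n → Set (E m) :=
  fun x => {y | y ∈ Γ x ∧ ∀ z ∈ Γ x, f x y ≤ f x z}

/-- The optimal value function `φ(x) = inf_y {f(x, y) | y ∈ Γ(x)}`, with values in `[-∞, ∞]`. -/
def optimalValue (f : E n → E m → ℝ) (Γ : E n → Set (E m)) (x : E n) : EReal :=
  ⨅ y ∈ Γ x, (f x y : EReal)

/-- The inequality constraint functions of the value function description of `S`: the index
`none` carries `f(x, y) - φ(x)`, the index `some i` carries `g i`. -/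
def solutionIneq {ℓ q : ℕ} (f : E n → E m → ℝ)
    (g : Fin ℓ → E n → E m → ℝ) (h : Fin q → E n → E m → ℝ) :
    Option (Fin ℓ) → E n → E m → EReal
  | none => fun x y => (f x y : EReal) - optimalValue f (feasibleMap g h) x
  | some i => fun x y => (g i x y : EReal)

/-- RCPLD w.r.t. `Ω` for the value function description of the solution mapping
`S(x) = {y | f(x, y) - φ(x) ≤ 0, g i (x, y) ≤ 0, h j (x, y) = 0}`. -/
def RCPLDSolutionAt {ℓ q : ℕ} (f : E n → E m → ℝ)
    (g : Fin ℓ → E n → E m → ℝ) (h : Fin q → E n → E m → ℝ)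
    (Ω : Set (E n)) (xbar : E n) (ybar : E m) : Prop :=
  RCPLDAt (solutionIneq f g h) (fun j x y => (h j x y : EReal)) Ω xbar ybar

/-- Joint continuous differentiability of a function of `(x, y)`. -/
def JointlyC1 (c : E n → E m → ℝ) : Prop :=
  ContDiff ℝ 1 fun z : E n × E m => c z.1 z.2

/-- For each `x`, the objective and the inequality constraint functions are convex in `y`, and
the equality constraint functions are affine in `y`. -/
def ConvexData {ℓ q : ℕ} (f : E n → E m → ℝ)
    (g : Fin ℓ → E n → E m → ℝ) (h : Fin q → E n → E m → ℝ) : Prop :=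
  ∀ x, ConvexOn ℝ Set.univ (f x) ∧ (∀ i, ConvexOn ℝ Set.univ (g i x)) ∧
    ∀ j, ∃ A : E m →ᵃ[ℝ] ℝ, ∀ y, h j x y = A y

end ParamOpt

end

/-! The core is a stability statement for convex systems, `eventually_exists_feasible_near`: under
the qualification condition, every solvable system with parameter near `xbar` has a solution near
`ybar`. Suppose this fails. The quadratic penalty has no zero in a small ball around `ybar`, so its
minimizer `y` there lies on the sphere, and `ybar - y` is a conic combination of gradients of
violated inequalities plus equality gradients. By Carathéodory these gradients may be taken linearly
independent. In the limit `y₀` is feasible and the violated inequalities become active. Either the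
limiting gradients are positive-linearly dependent, which the qualification condition turns into
dependence nearby, a contradiction; or `ybar - y₀` is normal at `y₀` to a convex set containing
`ybar`, impossible as `y₀ ≠ ybar`.

This is applied twice to `Γ` with the extra constraint `f ≤ ψ`. A large constant `ψ` makes the
constraint vacuous and yields upper semicontinuity of `φ`; compactness yields lower semicontinuity.
Since `φ` is thus continuous at `xbar` relative to `dom Γ`, `ψ = φ` is admissible and gives the
theorem. -/

open Filter Set

namespace ParamOpt

/-! ### Closedness of positive-linear dependence -/

section PosLinDep

variable {ι κ V : Type*} [Fintype ι] [Fintype κ] [NormedAddCommGroup V] [NormedSpace ℝ V]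

/-- The coefficients in a positive-linear dependence can be normalized. -/
lemma PosLinDep.exists_norm_eq_one {a : ι → V} {b : κ → V} (hab : PosLinDep a b) :
    ∃ p : (ι → ℝ) × (κ → ℝ), ‖p‖ = 1 ∧ (∀ i, 0 ≤ p.1 i) ∧
      ∑ i, p.1 i • a i + ∑ j, p.2 j • b j = 0 := by
  obtain ⟨α, β, hα, hne, hsum⟩ := hab
  have hp : (α, β) ≠ 0 := by
    rintro h0
    obtain ⟨rfl, rfl⟩ := Prod.mk_eq_zero.1 h0
    simp at hne
  refine ⟨‖(α, β)‖⁻¹ • (α, β), norm_smul_inv_norm (𝕜 := ℝ) hp, fun i => ?_, ?_⟩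
  · exact mul_nonneg (by positivity) (hα i)
  · simp only [Prod.smul_mk, Pi.smul_apply, smul_eq_mul, mul_smul, ← Finset.smul_sum]
    rw [← smul_add, hsum, smul_zero]

/-- Positive-linear dependence is preserved under limits. -/
lemma PosLinDep.of_tendsto {X : Type*} {l : Filter X} [l.NeBot] {a : X → ι → V} {b : X → κ → V}
    {a₀ : ι → V} {b₀ : κ → V} (ha : ∀ i, Tendsto (fun x => a x i) l (𝓝 (a₀ i)))
    (hb : ∀ j, Tendsto (fun x => b x j) l (𝓝 (b₀ j)))
    (hab : ∀ᶠ x in l, PosLinDep (a x) (b x)) : PosLinDep a₀ b₀ := by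
  have hp : ∀ x, ∃ p : (ι → ℝ) × (κ → ℝ), PosLinDep (a x) (b x) →
      ‖p‖ = 1 ∧ (∀ i, 0 ≤ p.1 i) ∧ ∑ i, p.1 i • a x i + ∑ j, p.2 j • b x j = 0 := fun x => by
    by_cases hx : PosLinDep (a x) (b x)
    · obtain ⟨p, hp⟩ := hx.exists_norm_eq_one
      exact ⟨p, fun _ => hp⟩
    · exact ⟨0, fun h => absurd h hx⟩
  choose p hp using hp
  -- Normalized coefficients converge along an ultrafilter by compactness of the sphere, and their
  -- limit cannot vanish.
  have hsph : ∀ᶠ x in Ultrafilter.of l, p x ∈ Metric.sphere (0 : (ι → ℝ) × (κ → ℝ)) 1 :=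
    Ultrafilter.of_le l (hab.mono fun x hx => by simpa using (hp x hx).1)
  obtain ⟨p₀, hp₀, hlim⟩ := (isCompact_sphere (0 : (ι → ℝ) × (κ → ℝ)) 1).ultrafilter_le_nhds
    ((Ultrafilter.of l).map p) (le_principal_iff.2 hsph)
  have hlim : Tendsto p (Ultrafilter.of l : Filter X) (𝓝 p₀) := hlim
  have hab' := (Ultrafilter.of_le l) hab
  have h1 : ∀ i, Tendsto (fun x => (p x).1 i) (Ultrafilter.of l : Filter X) (𝓝 (p₀.1 i)) :=
    fun i => ((continuous_apply i).comp continuous_fst).continuousAt.tendsto.comp hlim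
  have h2 : ∀ j, Tendsto (fun x => (p x).2 j) (Ultrafilter.of l : Filter X) (𝓝 (p₀.2 j)) :=
    fun j => ((continuous_apply j).comp continuous_snd).continuousAt.tendsto.comp hlim
  refine ⟨p₀.1, p₀.2, fun i => ?_, ?_, ?_⟩
  · exact ge_of_tendsto (h1 i) (mem_of_superset hab' fun x hx => (hp x hx).2.1 i)
  · by_contra! hz
    have : p₀ = 0 := Prod.ext (funext hz.1) (funext hz.2)
    simp [this] at hp₀
  · refine tendsto_nhds_unique ((tendsto_finsetSum _ fun i _ => (h1 i).smul
      ((ha i).mono_left (Ultrafilter.of_le l))).add (tendsto_finsetSum _ fun j _ => (h2 j).smul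
      ((hb j).mono_left (Ultrafilter.of_le l)))) ?_
    exact tendsto_const_nhds.congr' (mem_of_superset hab' fun x hx => ((hp x hx).2.2).symm)

end PosLinDep

/-! ### Conic Carathéodory reduction -/

section Caratheodory

variable {ι κ V : Type*} [AddCommGroup V] [Module ℝ V]

/-- Conic Carathéodory theorem: the generators of a conic combination can be reduced to a
linearly independent subfamily. -/
lemma exists_linearIndependent_conic_combination (a : ι → V) (K : Finset ι) (lam : ι → ℝ)
    (hlam : ∀ i ∈ K, 0 ≤ lam i) :
    ∃ K' ⊆ K, ∃ lam' : ι → ℝ, (∀ i ∈ K', 0 ≤ lam' i) ∧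
      ∑ i ∈ K', lam' i • a i = ∑ i ∈ K, lam i • a i ∧ LinearIndependent ℝ (fun i : K' => a i) := by
  classical
  induction K using Finset.strongInduction generalizing lam with
  | H K ih =>
    by_cases hind : LinearIndependent ℝ (fun i : K => a i)
    · exact ⟨K, subset_rfl, lam, hlam, rfl, hind⟩
    · obtain ⟨α, hsum, i₀, hi₀K, hi₀⟩ : ∃ α : ι → ℝ, ∑ i ∈ K, α i • a i = 0 ∧
          ∃ i ∈ K, 0 < α i := by
        have : ∃ α : ι → ℝ, ∑ i ∈ K, α i • a i = 0 ∧ ∃ i ∈ K, α i ≠ 0 := by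
          rw [Fintype.not_linearIndependent_iff] at hind
          obtain ⟨γ, hγ, i, hi⟩ := hind
          refine ⟨fun j => if hj : j ∈ K then γ ⟨j, hj⟩ else 0, ?_, i, i.2, by simpa using hi⟩
          rw [← hγ, ← Finset.sum_coe_sort K]
          simp
        obtain ⟨α, hsum, i, hiK, hi⟩ := this
        rcases hi.lt_or_gt with hneg | hpos
        · exact ⟨-α, by simp [hsum], i, hiK, by simpa using hneg⟩
        · exact ⟨α, hsum, i, hiK, hpos⟩
      -- The minimal ratio is the largest `t` keeping every `lam i - t * α i` nonnegative; the
      -- coefficient at `k` then vanishes.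
      obtain ⟨k, hk, hmin⟩ := (K.filter fun i => 0 < α i).exists_min_image
        (fun i => lam i / α i) ⟨i₀, by simp [hi₀K, hi₀]⟩
      obtain ⟨hkK, hkpos⟩ := Finset.mem_filter.1 hk
      set t := lam k / α k with ht
      have ht0 : 0 ≤ t := div_nonneg (hlam k hkK) hkpos.le
      obtain ⟨K', hK', lam', h1, h2, h3⟩ := ih (K.erase k) (Finset.erase_ssubset hkK)
        (fun i => lam i - t * α i) (fun i hi => by
          have hiK := Finset.mem_of_mem_erase hi
          rcases lt_or_ge 0 (α i) with hpos | hneg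
          · have := (le_div_iff₀ hpos).1 (hmin i (by simp [hiK, hpos]))
            linarith
          · nlinarith [hlam i hiK])
      refine ⟨K', hK'.trans (Finset.erase_subset _ _), lam', h1, ?_, h3⟩
      rw [h2, Finset.sum_erase]
      · simp only [sub_smul, Finset.sum_sub_distrib, mul_smul, ← Finset.smul_sum, hsum]
        simp
      · rw [ht, div_mul_cancel₀ _ hkpos.ne', sub_self, zero_smul]

/-- Carathéodory reduction of a conic combination modulo a linearly independent family. -/
lemma exists_linearIndependent_sumElim (a : ι → V) (K : Finset ι) (lam : ι → ℝ)
    (hlam : ∀ i ∈ K, 0 ≤ lam i) [Fintype κ] (b : κ → V) (hb : LinearIndependent ℝ b) (w : V)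
    (hw : w ∈ Submodule.span ℝ (range b)) :
    ∃ K' ⊆ K, ∃ (lam' : ι → ℝ) (β : κ → ℝ), (∀ i ∈ K', 0 ≤ lam' i) ∧
      ∑ i ∈ K, lam i • a i + w = ∑ i ∈ K', lam' i • a i + ∑ j, β j • b j ∧
      LinearIndependent ℝ (Sum.elim (fun i : K' => a i) b) := by
  set W := Submodule.span ℝ (range b) with hW
  -- Reducing modulo `W` makes the kept vectors independent of `b` as well; the error lies in `W`
  -- and is absorbed by `β`.
  obtain ⟨K', hK', lam', h1, h2, h3⟩ :=
    exists_linearIndependent_conic_combination (fun i => W.mkQ (a i)) K lam hlam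
  have hmem : ∑ i ∈ K, lam i • a i - ∑ i ∈ K', lam' i • a i ∈ W := by
    rw [← Submodule.Quotient.eq, ← Submodule.mkQ_apply, ← Submodule.mkQ_apply]
    simp only [map_sum, map_smul]
    exact h2.symm
  obtain ⟨β, hβ⟩ := (Submodule.mem_span_range_iff_exists_fun ℝ).1 (W.add_mem hmem hw)
  refine ⟨K', hK', lam', β, h1, by rw [hβ]; abel, ?_⟩
  have hb' : LinearIndependent ℝ
      (fun j => (⟨b j, Submodule.subset_span (mem_range_self j)⟩ : W)) := by
    apply LinearIndependent.of_comp W.subtype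
    exact hb
  have := LinearIndependent.sumElim_of_quotient hb' (fun i : K' => a i) h3
  have := this.comp (Equiv.sumComm _ _) (Equiv.injective _)
  have hfun : Sum.elim (fun i : K' => a i) b =
      Sum.elim b (fun i : K' => a i) ∘ Equiv.sumComm K' κ := by
    ext (i | j) <;> rfl
  rw [hfun]
  exact this

end Caratheodory

/-! ### Quadratic penalty and its minimizers on a ball -/

section Penalty

/-- Squaring removes the kink at zero: the first-order remainder is at most `(s - t) ^ 2` in every
sign case. -/
lemma hasDerivAt_sq_max_zero (t : ℝ) :
    HasDerivAt (fun s : ℝ => (max s 0) ^ 2) (2 * max t 0) t := by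
  rw [hasDerivAt_iff_isLittleO]
  have h : (fun s => (max s 0) ^ 2 - (max t 0) ^ 2 - (s - t) • (2 * max t 0)) =O[𝓝 t]
      fun s => (s - t) ^ 2 := by
    refine Asymptotics.IsBigO.of_bound 1 (Eventually.of_forall fun s => ?_)
    rw [Real.norm_eq_abs, Real.norm_eq_abs, one_mul, abs_le, abs_of_nonneg (sq_nonneg _),
      smul_eq_mul]
    rcases max_cases s 0 with ⟨h1, h1'⟩ | ⟨h1, h1'⟩ <;>
      rcases max_cases t 0 with ⟨h2, h2'⟩ | ⟨h2, h2'⟩ <;> rw [h1, h2] <;>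
      constructor <;> nlinarith
  refine h.trans_isLittleO ?_
  have : (fun s : ℝ => (s - t) ^ 2) =o[𝓝 t] fun s => (s - t) ^ 1 :=
    (Asymptotics.isLittleO_pow_pow one_lt_two).comp_tendsto
      (tendsto_sub_nhds_zero_iff.2 tendsto_id)
  simpa using this

/-- The quadratic penalty function of a system of inequalities and equations. -/
def penalty {ι κ V : Type*} [Fintype ι] [Fintype κ] (c : ι → V → ℝ) (e : κ → V → ℝ) (y : V) : ℝ :=
  ∑ i, (max (c i y) 0) ^ 2 + ∑ j, (e j y) ^ 2

variable {ι κ V : Type*} [Fintype ι] [Fintype κ]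

lemma penalty_nonneg (c : ι → V → ℝ) (e : κ → V → ℝ) (y : V) : 0 ≤ penalty c e y := by
  unfold penalty; positivity

lemma penalty_eq_zero_iff {c : ι → V → ℝ} {e : κ → V → ℝ} {y : V} :
    penalty c e y = 0 ↔ (∀ i, c i y ≤ 0) ∧ ∀ j, e j y = 0 := by
  unfold penalty
  rw [add_eq_zero_iff_of_nonneg (by positivity) (by positivity),
    Finset.sum_eq_zero_iff_of_nonneg (fun _ _ => by positivity),
    Finset.sum_eq_zero_iff_of_nonneg (fun _ _ => by positivity)]
  simp

variable [NormedAddCommGroup V] [InnerProductSpace ℝ V]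

/-- First-order inequality for convex functions. -/
lemma _root_.ConvexOn.inner_gradient_le {φ : V → ℝ} (hφ : ConvexOn ℝ univ φ) {G y : V}
    (hG : HasFDerivAt φ (innerSL ℝ G) y) (z : V) : inner ℝ G (z - y) ≤ φ z - φ y := by
  have hconv : ConvexOn ℝ univ (fun t : ℝ => φ (AffineMap.lineMap y z t)) := by
    simpa using! hφ.comp_affineMap (AffineMap.lineMap (k := ℝ) y z)
  have hd : HasDerivAt (fun t : ℝ => φ (AffineMap.lineMap y z t)) (inner ℝ G (z - y)) 0 := by
    have h1 : HasDerivAt (fun t : ℝ => (AffineMap.lineMap y z t : V)) (z - y) 0 :=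
      AffineMap.hasDerivAt_lineMap
    have := HasFDerivAt.comp_hasDerivAt (f := fun t : ℝ => (AffineMap.lineMap y z t : V))
      (l := φ) 0 (by simpa using hG) h1
    simpa using! this
  have := hconv.le_slope_of_hasDerivAt (mem_univ 0) (mem_univ 1) one_pos hd
  simpa [slope_def_field] using this

/-- If a convex system is solvable but has no solution in a closed ball around `ybar`, then a
minimizer `y` of the quadratic penalty over that ball lies on the boundary sphere, and `ybar - y`
is a combination of gradients at `y`, where only violated inequalities contribute. -/
lemma exists_penalty_stationary [FiniteDimensional ℝ V] {c : ι → V → ℝ} {e : κ → V → ℝ} {Gc : ι → V → V} {Ge : κ → V → V}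
    (hc : ∀ i y, HasFDerivAt (c i) (innerSL ℝ (Gc i y)) y)
    (he : ∀ j y, HasFDerivAt (e j) (innerSL ℝ (Ge j y)) y)
    (hc' : ∀ i y z, inner ℝ (Gc i y) (z - y) ≤ c i z - c i y)
    (he' : ∀ j y z, inner ℝ (Ge j y) (z - y) = e j z - e j y)
    {u : V} (hu : (∀ i, c i u ≤ 0) ∧ ∀ j, e j u = 0) {ybar : V} {δ : ℝ} (hδ : 0 < δ)
    (hinf : ∀ y ∈ Metric.closedBall ybar δ, ¬((∀ i, c i y ≤ 0) ∧ ∀ j, e j y = 0)) :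
    ∃ y, ‖ybar - y‖ = δ ∧ penalty c e y ≤ penalty c e ybar ∧
      ∃ (lam : ι → ℝ) (mu : κ → ℝ), (∀ i, 0 ≤ lam i) ∧ (∀ i, lam i ≠ 0 → 0 < c i y) ∧
        ybar - y = ∑ i, lam i • Gc i y + ∑ j, mu j • Ge j y := by
  have hder : ∀ y, HasFDerivAt (penalty c e)
      (innerSL ℝ (∑ i, (2 * max (c i y) 0) • Gc i y + ∑ j, (2 * e j y) • Ge j y)) y := by
    intro y
    have h1 : ∀ i, HasFDerivAt (fun z => (max (c i z) 0) ^ 2)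
        ((2 * max (c i y) 0) • innerSL ℝ (Gc i y)) y := fun i =>
      (hasDerivAt_sq_max_zero (c i y)).comp_hasFDerivAt y (hc i y)
    have h2 : ∀ j, HasFDerivAt (fun z => (e j z) ^ 2)
        ((2 * e j y) • innerSL ℝ (Ge j y)) y := fun j => by
      simpa using (he j y).pow 2
    have := (HasFDerivAt.fun_sum (u := Finset.univ) fun i _ => h1 i).add
      (HasFDerivAt.fun_sum (u := Finset.univ) fun j _ => h2 j)
    simp only [map_add, map_sum, map_smul]
    exact this
  have hcont : Continuous (penalty c e) :=
    continuous_iff_continuousAt.2 fun y => (hder y).continuousAt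
  obtain ⟨y, hyb, hmin⟩ := (isCompact_closedBall ybar δ).exists_isMinOn
    (Metric.nonempty_closedBall.2 hδ.le) hcont.continuousOn
  have hpos : 0 < penalty c e y :=
    (penalty_nonneg c e y).lt_of_ne fun h0 => hinf y hyb (penalty_eq_zero_iff.1 h0.symm)
  set G := ∑ i, (2 * max (c i y) 0) • Gc i y + ∑ j, (2 * e j y) • Ge j y with hG
  -- By convexity, the slope of the penalty toward the solution `u` is at most `-2` times its
  -- positive value, so `y` is not stationary.
  have hGneg : inner ℝ G (u - y) < 0 := by
    have h1 : inner ℝ G (u - y) = ∑ i, (2 * max (c i y) 0) * inner ℝ (Gc i y) (u - y) +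
        ∑ j, (2 * e j y) * inner ℝ (Ge j y) (u - y) := by
      simp [hG, inner_add_left, sum_inner, real_inner_smul_left]
    have h2 : ∑ i, (2 * max (c i y) 0) * inner ℝ (Gc i y) (u - y) ≤
        ∑ i, -2 * (max (c i y) 0) ^ 2 := by
      refine Finset.sum_le_sum fun i _ => ?_
      have h3 := hc' i y u
      have h4 := hu.1 i
      rcases max_cases (c i y) 0 with ⟨h5, h5'⟩ | ⟨h5, h5'⟩ <;> rw [h5] <;> nlinarith
    have h3 : ∑ j, (2 * e j y) * inner ℝ (Ge j y) (u - y) = ∑ j, -2 * (e j y) ^ 2 := by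
      refine Finset.sum_congr rfl fun j _ => ?_
      rw [he' j y u, hu.2 j]; ring
    have h4 : ∑ i, -2 * (max (c i y) 0) ^ 2 + ∑ j, -2 * (e j y) ^ 2 = -2 * penalty c e y := by
      rw [penalty, mul_add, Finset.mul_sum, Finset.mul_sum]
    rw [h1, h3]
    linarith
  have hG0 : G ≠ 0 := by
    rintro h0
    simp [h0] at hGneg
  have hGn : 0 < ‖G‖ := norm_pos_iff.2 hG0
  have hvar : ∀ z ∈ Metric.closedBall ybar δ, 0 ≤ inner ℝ G (z - y) := fun z hz => by
    have := hmin.localize.hasFDerivWithinAt_nonneg (hder y).hasFDerivWithinAt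
      (sub_mem_posTangentConeAt_of_segment_subset
        ((convex_closedBall ybar δ).segment_subset hyb hz))
    rwa [innerSL_apply_apply] at this
  have hle : ‖ybar - y‖ ≤ δ := by simpa [dist_eq_norm, norm_sub_rev] using hyb
  have hge : δ * ‖G‖ ≤ inner ℝ G (ybar - y) := by
    -- This point minimizes `inner ℝ G` over the ball. Testing against it forces equality in
    -- Cauchy–Schwarz, hence `ybar - y = (δ / ‖G‖) • G`.
    have hz : ybar - (δ / ‖G‖) • G ∈ Metric.closedBall ybar δ := by
      simp [norm_smul, abs_of_pos hδ, div_mul_cancel₀ _ hGn.ne']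
    have h1 := hvar _ hz
    rw [sub_right_comm, inner_sub_right, real_inner_smul_right, real_inner_self_eq_norm_sq] at h1
    have h2 : δ / ‖G‖ * ‖G‖ ^ 2 = δ * ‖G‖ := by field_simp
    linarith
  have hcs := real_inner_le_norm G (ybar - y)
  have hnorm : ‖ybar - y‖ = δ := by
    refine le_antisymm hle ?_
    by_contra! hlt
    nlinarith
  refine ⟨y, hnorm, hmin (Metric.mem_closedBall_self hδ.le),
    fun i => δ / ‖G‖ * (2 * max (c i y) 0), fun j => δ / ‖G‖ * (2 * e j y), fun i => by positivity,
    fun i hi => ?_, ?_⟩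
  · by_contra! hneg
    simp [max_eq_right hneg] at hi
  · have heq : inner ℝ G (ybar - y) = ‖G‖ * ‖ybar - y‖ := by
      refine le_antisymm hcs ?_
      rw [hnorm]; linarith
    rw [inner_eq_norm_mul_iff_real, hnorm] at heq
    simp only [mul_smul _ (_ * _), ← Finset.smul_sum]
    rw [← smul_add, ← hG, div_eq_inv_mul, mul_smul, heq, smul_smul, inv_mul_cancel₀ hGn.ne',
      one_smul]

end Penalty

/-! ### Stability of convex systems -/

section Stability

/-- If a convex differentiable system depending on a parameter satisfies the relaxed constant
positive linear dependence constraint qualification at a feasible point `(xbar, ybar)` relative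
to `Ω`, then, for all parameters in `Ω` near `xbar`, solvability of the system implies the
existence of solutions close to `ybar`. -/
theorem eventually_exists_feasible_near {X ι κ V : Type*} [TopologicalSpace X]
    [Fintype ι] [Fintype κ] [NormedAddCommGroup V] [InnerProductSpace ℝ V] [FiniteDimensional ℝ V]
    {c : ι → X → V → ℝ} {e : κ → X → V → ℝ} {Gc : ι → X → V → V} {Ge : κ → X → V → V}
    (hc : ∀ i x y, HasFDerivAt (c i x) (innerSL ℝ (Gc i x y)) y)
    (he : ∀ j x y, HasFDerivAt (e j x) (innerSL ℝ (Ge j x y)) y)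
    (hc' : ∀ i x y z, inner ℝ (Gc i x y) (z - y) ≤ c i x z - c i x y)
    (he' : ∀ j x y z, inner ℝ (Ge j x y) (z - y) = e j x z - e j x y)
    (hGc : ∀ i, Continuous fun z : X × V => Gc i z.1 z.2)
    (hGe : ∀ j, Continuous fun z : X × V => Ge j z.1 z.2)
    {Ω : Set X} {xbar : X} {ybar : V}
    (hcc : ∀ i y, Tendsto (fun z : X × V => c i z.1 z.2) (𝓝[Ω] xbar ×ˢ 𝓝 y) (𝓝 (c i xbar y)))
    (hec : ∀ j y, Tendsto (fun z : X × V => e j z.1 z.2) (𝓝[Ω] xbar ×ˢ 𝓝 y) (𝓝 (e j xbar y)))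
    (hfeas : (∀ i, c i xbar ybar ≤ 0) ∧ ∀ j, e j xbar ybar = 0)
    {B : Finset κ} (hB : LinearIndependent ℝ (fun j : B => Ge j xbar ybar))
    (hspan : ∀ᶠ z in 𝓝[Ω] xbar ×ˢ 𝓝 ybar, ∀ j, Ge j z.1 z.2 ∈
      Submodule.span ℝ (range fun j : B => Ge j z.1 z.2))
    (hdep : ∀ K : Finset ι, (∀ i ∈ K, c i xbar ybar = 0) →
      PosLinDep (fun i : K => Gc i xbar ybar) (fun j : B => Ge j xbar ybar) →
      ∀ᶠ z in 𝓝[Ω] xbar ×ˢ 𝓝 ybar, ¬ LinearIndependent ℝ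
        (Sum.elim (fun i : K => Gc i z.1 z.2) (fun j : B => Ge j z.1 z.2)))
    {ε : ℝ} (hε : 0 < ε) :
    ∀ᶠ x in 𝓝[Ω] xbar, (∃ u, (∀ i, c i x u ≤ 0) ∧ ∀ j, e j x u = 0) →
      ∃ y ∈ Metric.ball ybar ε, (∀ i, c i x y ≤ 0) ∧ ∀ j, e j x y = 0 := by
  classical
  by_contra hcon
  have hlim : ∀ {l : Filter X} {y : X → V} {y₀ : V}, l ≤ 𝓝 xbar → Tendsto y l (𝓝 y₀) →
      (∀ i, Tendsto (fun x => Gc i x (y x)) l (𝓝 (Gc i xbar y₀))) ∧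
      ∀ j, Tendsto (fun x => Ge j x (y x)) l (𝓝 (Ge j xbar y₀)) := fun hl hy =>
    ⟨fun i => ((hGc i).tendsto (xbar, _)).comp (Tendsto.prodMk_nhds hl hy),
      fun j => ((hGe j).tendsto (xbar, _)).comp (Tendsto.prodMk_nhds hl hy)⟩
  -- the qualification condition in a neighborhood of `ybar`
  have hact : ∀ᶠ y in 𝓝 ybar, ∀ i, c i xbar y = 0 → c i xbar ybar = 0 := by
    refine eventually_all.2 fun i => ?_
    rcases (hfeas.1 i).lt_or_eq with hlt | heq
    · have hci : ContinuousAt (c i xbar) ybar := (hc i xbar ybar).continuousAt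
      filter_upwards [hci.eventually_lt_const hlt] with y hy hy0
      exact absurd hy0 hy.ne
    · exact Eventually.of_forall fun _ _ => heq
  -- Dependence at points arbitrarily close to `ybar` would pass to the limit; there are only
  -- finitely many `K`.
  have hpld : ∀ᶠ y in 𝓝 ybar, ∀ K : Finset ι,
      PosLinDep (fun i : K => Gc i xbar y) (fun j : B => Ge j xbar y) →
      PosLinDep (fun i : K => Gc i xbar ybar) (fun j : B => Ge j xbar ybar) := by
    refine eventually_all.2 fun K => ?_
    by_contra hK
    have hfr : ∃ᶠ y in 𝓝 ybar, PosLinDep (fun i : K => Gc i xbar y) (fun j : B => Ge j xbar y) :=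
      fun h => hK (h.mono fun y hy h' => absurd h' hy)
    have hnot : ¬ PosLinDep (fun i : K => Gc i xbar ybar) (fun j : B => Ge j xbar ybar) :=
      fun h => hK (Eventually.of_forall fun _ _ => h)
    have : (𝓝 ybar ⊓ 𝓟 {y | PosLinDep (fun i : K => Gc i xbar y)
        (fun j : B => Ge j xbar y)}).NeBot := frequently_mem_iff_neBot.1 hfr
    refine hnot (PosLinDep.of_tendsto (l := 𝓝 ybar ⊓ 𝓟 {y | PosLinDep (fun i : K => Gc i xbar y)
        (fun j : B => Ge j xbar y)}) (fun i => ?_) (fun j => ?_)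
        (mem_inf_of_right (mem_principal_self _)))
    · exact (((hGc i).comp (Continuous.prodMk_right xbar)).tendsto ybar).mono_left inf_le_left
    · exact (((hGe j).comp (Continuous.prodMk_right xbar)).tendsto ybar).mono_left inf_le_left
  have hBev : ∀ᶠ z in 𝓝[Ω] xbar ×ˢ 𝓝 ybar, LinearIndependent ℝ (fun j : B => Ge j z.1 z.2) := by
    have hcB : Continuous fun z : X × V => fun j : B => Ge j z.1 z.2 :=
      continuous_pi fun j => hGe j
    have h1 : ∀ᶠ z in 𝓝 (xbar, ybar), LinearIndependent ℝ (fun j : B => Ge j z.1 z.2) :=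
      (isOpen_setOfPred_linearIndependent.preimage hcB).mem_nhds hB
    rw [nhds_prod_eq] at h1
    exact h1.filter_mono (prod_mono_left _ nhdsWithin_le_nhds)
  have hdep' : ∀ᶠ z in 𝓝[Ω] xbar ×ˢ 𝓝 ybar, ∀ K : Finset ι, (∀ i ∈ K, c i xbar ybar = 0) →
      PosLinDep (fun i : K => Gc i xbar ybar) (fun j : B => Ge j xbar ybar) →
      ¬ LinearIndependent ℝ
        (Sum.elim (fun i : K => Gc i z.1 z.2) (fun j : B => Ge j z.1 z.2)) := by
    refine eventually_all.2 fun K => ?_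
    by_cases h : (∀ i ∈ K, c i xbar ybar = 0) ∧
        PosLinDep (fun i : K => Gc i xbar ybar) (fun j : B => Ge j xbar ybar)
    · exact (hdep K h.1 h.2).mono fun z hz _ _ => hz
    · exact Eventually.of_forall fun z h1 h2 => absurd ⟨h1, h2⟩ h
  obtain ⟨p, hp, r, hr, hpr⟩ := eventually_prod_iff.1 (hspan.and (hBev.and hdep'))
  obtain ⟨δ₀, hδ₀, hball⟩ := Metric.eventually_nhds_iff_ball.1 (hact.and (hpld.and hr))
  set δ := min δ₀ ε / 2 with hδdef
  have hmin : 0 < min δ₀ ε := lt_min hδ₀ hε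
  have hδ : 0 < δ := by positivity
  have hδ₀' : δ < δ₀ := (half_lt_self hmin).trans_le (min_le_left _ _)
  have hδε : δ < ε := (half_lt_self hmin).trans_le (min_le_right _ _)
  -- an ultrafilter along which there are no solutions close to `ybar`
  set bad : Set X := {x | (∃ u, (∀ i, c i x u ≤ 0) ∧ ∀ j, e j x u = 0) ∧
      ∀ y ∈ Metric.ball ybar ε, ¬((∀ i, c i x y ≤ 0) ∧ ∀ j, e j x y = 0)} with hbad
  have hne : (𝓝[Ω] xbar ⊓ 𝓟 bad).NeBot := by
    refine frequently_mem_iff_neBot.1 fun h => hcon (h.mono fun x hx hu => ?_)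
    by_contra! hy
    exact hx ⟨hu, fun y hyb hyf => by obtain ⟨j, hj⟩ := hy y hyb hyf.1; exact hj (hyf.2 j)⟩
  set l : Ultrafilter X := Ultrafilter.of (𝓝[Ω] xbar ⊓ 𝓟 bad) with hl
  have hlΩ : (l : Filter X) ≤ 𝓝[Ω] xbar := (Ultrafilter.of_le _).trans inf_le_left
  have hlx : (l : Filter X) ≤ 𝓝 xbar := hlΩ.trans nhdsWithin_le_nhds
  have hlbad : ∀ᶠ x in l, x ∈ bad := (Ultrafilter.of_le _) (mem_inf_of_right (mem_principal_self _))
  -- The vector `-(ybar - y)` joins the family under `none`, with coefficient 1, so limits can be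
  -- taken without bounding the multipliers.
  have hex : ∀ᶠ x in l, ∃ K : Finset ι, ∃ y, ‖ybar - y‖ = δ ∧
      penalty (fun i => c i x) (fun j => e j x) y ≤
        penalty (fun i => c i x) (fun j => e j x) ybar ∧
      (∀ i ∈ K, 0 < c i x y) ∧
      LinearIndependent ℝ (Sum.elim (fun i : K => Gc i x y) (fun j : B => Ge j x y)) ∧
      PosLinDep (fun o : Option K => o.elim (-(ybar - y)) (fun i => Gc i x y))
        (fun j : B => Ge j x y) := by
    filter_upwards [hlbad, hlΩ hp] with x ⟨⟨u, hu⟩, hxb⟩ hpx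
    obtain ⟨y, hy, hyP, lam, mu, hlam, hlam', hsum⟩ := exists_penalty_stationary
      (fun i => hc i x) (fun j => he j x) (fun i => hc' i x) (fun j => he' j x) hu hδ
      (fun y hy => hxb y (Metric.closedBall_subset_ball hδε hy))
    have hyb : y ∈ Metric.ball ybar δ₀ := by
      rw [mem_ball_iff_norm', hy]; exact hδ₀'
    obtain ⟨hs, hBi, -⟩ := hpr hpx (hball y hyb).2.2
    obtain ⟨K, hK, lam', β, h1, h2, h3⟩ := exists_linearIndependent_sumElim
      (fun i => Gc i x y) (Finset.univ.filter fun i => lam i ≠ 0) lam (fun i _ => hlam i)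
      (fun j : B => Ge j x y) hBi (∑ j, mu j • Ge j x y)
      (Submodule.sum_smul_mem _ _ fun j _ => hs j)
    refine ⟨K, y, hy, hyP, fun i hi => hlam' i (by simpa using hK hi), h3,
      fun o => o.elim 1 (fun i => lam' i), β, ?_, Or.inl ⟨none, one_ne_zero⟩, ?_⟩
    · rintro (_ | i)
      · exact zero_le_one
      · exact h1 i i.2
    · rw [Finset.sum_filter_of_ne (p := fun i => lam i ≠ 0)
        (fun i _ h h0 => h (by rw [h0, zero_smul])), ← hsum] at h2
      rw [Fintype.sum_option]
      simp only [Option.elim_none, Option.elim_some, one_smul]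
      rw [add_assoc, Finset.sum_coe_sort K (fun i => lam' i • Gc i x y), ← h2]
      abel
  -- A single `K` works along the ultrafilter, since there are finitely many.
  obtain ⟨K, hK⟩ := Ultrafilter.eventually_exists_iff.1 hex
  obtain ⟨y, hy⟩ := hK.choice
  obtain ⟨y₀, hy₀, hlimy⟩ := (isCompact_sphere ybar δ).ultrafilter_le_nhds (l.map y)
    (le_principal_iff.2 (hy.mono fun x hx => by rw [mem_sphere_iff_norm, norm_sub_rev]; exact hx.1))
  have hlimy : Tendsto y l (𝓝 y₀) := hlimy
  have hnorm : ‖ybar - y₀‖ = δ := by rw [norm_sub_rev, ← mem_sphere_iff_norm]; exact hy₀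
  have hlimz : Tendsto (fun x => (x, y x)) l (𝓝[Ω] xbar ×ˢ 𝓝 y₀) := Tendsto.prodMk hlΩ hlimy
  have hlimb : Tendsto (fun x => (x, ybar)) l (𝓝[Ω] xbar ×ˢ 𝓝 ybar) :=
    Tendsto.prodMk hlΩ tendsto_const_nhds
  -- the limit point is feasible
  have hpen : ∀ {z : X → V} {z₀ : V}, Tendsto (fun x => (x, z x)) l (𝓝[Ω] xbar ×ˢ 𝓝 z₀) →
      Tendsto (fun x => penalty (fun i => c i x) (fun j => e j x) (z x)) l
        (𝓝 (penalty (fun i => c i xbar) (fun j => e j xbar) z₀)) := fun {z z₀} hz =>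
    (tendsto_finsetSum _ fun i _ =>
      (((hcc i z₀).comp hz).max tendsto_const_nhds).pow 2).add
      (tendsto_finsetSum _ fun j _ => ((hec j z₀).comp hz).pow 2)
  have hfeas₀ : (∀ i, c i xbar y₀ ≤ 0) ∧ ∀ j, e j xbar y₀ = 0 := by
    have h1 := le_of_tendsto_of_tendsto (hpen hlimz) (hpen hlimb) (hy.mono fun x hx => hx.2.1)
    rw [penalty_eq_zero_iff.2 hfeas] at h1
    exact penalty_eq_zero_iff.1 (le_antisymm h1 (penalty_nonneg _ _ _))
  have hactive : ∀ i ∈ K, c i xbar y₀ = 0 := fun i hi =>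
    le_antisymm (hfeas₀.1 i)
      (ge_of_tendsto ((hcc i y₀).comp hlimz) (hy.mono fun x hx => (hx.2.2.1 i hi).le))
  obtain ⟨hlimGc, hlimGe⟩ := hlim hlx hlimy
  have hPLD : PosLinDep (fun o : Option K => o.elim (-(ybar - y₀)) (fun i => Gc i xbar y₀))
      (fun j : B => Ge j xbar y₀) := by
    refine PosLinDep.of_tendsto (l := (l : Filter X))
      (a := fun x (o : Option K) => o.elim (-(ybar - y x)) (fun i => Gc i x (y x)))
      (b := fun x (j : B) => Ge j x (y x)) ?_ (fun j => hlimGe j) (hy.mono fun x hx => hx.2.2.2.2)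
    rintro (_ | i)
    · exact (tendsto_const_nhds.sub hlimy).neg
    · exact hlimGc i
  have hy₀b : y₀ ∈ Metric.ball ybar δ₀ := by
    rw [mem_ball_iff_norm', hnorm]; exact hδ₀'
  obtain ⟨hb1, hb2, hb3⟩ := hball y₀ hy₀b
  obtain ⟨α, β, hα, hne0, hsum⟩ := hPLD
  rw [Fintype.sum_option] at hsum
  simp only [Option.elim_none, Option.elim_some] at hsum
  rcases (hα none).eq_or_lt with h0 | hpos
  · -- positive-linear dependence of active gradients contradicts the independence nearby
    have hK0 := hb2 K ⟨fun i => α (some i), β, fun i => hα _, by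
      rcases hne0 with ⟨_ | i, hi⟩ | hj
      · exact absurd h0.symm hi
      · exact Or.inl ⟨i, hi⟩
      · exact Or.inr hj, by simpa [← h0] using hsum⟩
    obtain ⟨x, hx, hpx⟩ := (hy.and (hlΩ hp)).exists
    have hyx : y x ∈ Metric.ball ybar δ₀ := by
      rw [mem_ball_iff_norm', hx.1]; exact hδ₀'
    exact (hpr hpx (hball _ hyx).2.2).2.2 K (fun i hi => hb1 i (hactive i hi)) hK0 hx.2.2.2.1
  · -- otherwise `ybar - y₀` lies in the normal cone to the feasible set at `y₀`
    have h1 := congrArg (fun v => inner ℝ v (ybar - y₀)) hsum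
    simp only [inner_add_left, sum_inner, real_inner_smul_left, inner_neg_left, inner_zero_left,
      real_inner_self_eq_norm_sq, hnorm] at h1
    have h2 : ∑ i : K, α (some i) * inner ℝ (Gc i xbar y₀) (ybar - y₀) ≤ 0 := by
      refine Finset.sum_nonpos fun i _ => mul_nonpos_of_nonneg_of_nonpos (hα _) ?_
      have := hc' i xbar y₀ ybar
      rw [hactive i i.2] at this
      linarith [hfeas.1 i]
    have h3 : ∑ j : B, β j * inner ℝ (Ge j xbar y₀) (ybar - y₀) = 0 := by
      refine Finset.sum_eq_zero fun j _ => ?_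
      rw [he', hfeas.2, hfeas₀.2]; simp
    -- Pairing the relation with `ybar - y₀` equates this number with a nonpositive one.
    have h4 : 0 < α none * δ ^ 2 := by positivity
    linarith

end Stability

/-! ### Partial gradients of smooth data -/

section JointlyC1

variable {n m : ℕ} {F : E n → E m → ℝ}

lemma JointlyC1.continuous (hF : JointlyC1 F) : Continuous fun z : E n × E m => F z.1 z.2 :=
  ContDiff.continuous hF

lemma JointlyC1.hasFDerivAt_comp (hF : JointlyC1 F) (x : E n) (y : E m) :
    HasFDerivAt (F x) ((fderiv ℝ (fun z : E n × E m => F z.1 z.2) (x, y)).comp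
      (ContinuousLinearMap.inr ℝ (E n) (E m))) y :=
  ((ContDiff.differentiable hF one_ne_zero) (x, y)).hasFDerivAt.comp y (hasFDerivAt_prodMk_right x y)

lemma JointlyC1.hasFDerivAt (hF : JointlyC1 F) (x : E n) (y : E m) :
    HasFDerivAt (F x) (innerSL ℝ (gradient (F x) y)) y :=
  hasGradientAt_iff_hasFDerivAt.1 (hF.hasFDerivAt_comp x y).differentiableAt.hasGradientAt

lemma JointlyC1.continuous_gradient (hF : JointlyC1 F) :
    Continuous fun z : E n × E m => gradient (F z.1) z.2 := by
  have h1 : Continuous (fderiv ℝ (fun z : E n × E m => F z.1 z.2)) :=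
    ContDiff.continuous_fderiv hF one_ne_zero
  have h2 : (fun z : E n × E m => gradient (F z.1) z.2) = fun z =>
      (InnerProductSpace.toDual ℝ (E m)).symm ((fderiv ℝ (fun z : E n × E m => F z.1 z.2) z).comp
        (ContinuousLinearMap.inr ℝ (E n) (E m))) := by
    ext1 ⟨x, y⟩
    rw [gradient, (hF.hasFDerivAt_comp x y).fderiv]
  rw [h2]
  exact (LinearIsometryEquiv.continuous _).comp (h1.clm_comp continuous_const)

lemma gradY_coe (F : E n → E m → ℝ) (x : E n) (y : E m) :
    gradY (fun x y => (F x y : EReal)) x y = gradient (F x) y := by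
  simp [gradY]

/-- An affine function is convex and concave, so the two first-order inequalities combine. -/
lemma inner_gradient_eq_of_affine (hF : JointlyC1 F) {x : E n}
    (hA : ∃ A : E m →ᵃ[ℝ] ℝ, ∀ y, F x y = A y) (y z : E m) :
    inner ℝ (gradient (F x) y) (z - y) = F x z - F x y := by
  obtain ⟨A, hA⟩ := hA
  have hFA : F x = A := funext hA
  have hconv : ConvexOn ℝ univ (F x) := by
    rw [hFA]
    refine ⟨convex_univ, fun u _ v _ a b _ _ hab => le_of_eq ?_⟩
    exact Convex.combo_affine_apply hab
  have hconc : ConvexOn ℝ univ (-F x) := by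
    rw [hFA]
    refine ⟨convex_univ, fun u _ v _ a b _ _ hab => le_of_eq ?_⟩
    simp only [Pi.neg_apply, Convex.combo_affine_apply hab, smul_eq_mul]
    ring
  have h1 := hconv.inner_gradient_le (hF.hasFDerivAt x y) z
  have h2 := hconc.inner_gradient_le (G := -gradient (F x) y)
    (by rw [map_neg]; exact (hF.hasFDerivAt x y).neg) z
  simp only [inner_neg_left, Pi.neg_apply] at h2
  linarith

end JointlyC1

/-! ### Value function and sublevel systems -/

section SolutionMap

variable {n m ℓ q : ℕ} {f : E n → E m → ℝ} {g : Fin ℓ → E n → E m → ℝ}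
  {h : Fin q → E n → E m → ℝ} {xbar : E n}

lemma optimalValue_eq_of_mem {Γ : E n → Set (E m)} {x : E n} {y : E m}
    (hy : y ∈ solutionMap f Γ x) : optimalValue f Γ x = (f x y : EReal) :=
  le_antisymm (iInf₂_le y hy.1) (le_iInf₂ fun z hz => EReal.coe_le_coe_iff.2 (hy.2 z hz))

lemma isClosed_graph_feasibleMap (hg : ∀ i, JointlyC1 (g i)) (hh : ∀ j, JointlyC1 (h j)) :
    IsClosed {z : E n × E m | z.2 ∈ feasibleMap g h z.1} := by
  have h1 := (isClosed_iInter fun i => isClosed_le (hg i).continuous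
    (continuous_const (y := (0 : ℝ)))).inter (isClosed_iInter fun j =>
      isClosed_eq (hh j).continuous (continuous_const (y := (0 : ℝ))))
  convert h1 using 1
  ext z
  simp [feasibleMap]

/-- Local boundedness yields a common compact set containing the feasible sets. -/
lemma LocallyBoundedAt.exists_isCompact {Γ : E n → Set (E m)} (hΓ : LocallyBoundedAt Γ xbar) :
    ∃ C : Set (E m), IsCompact C ∧ ∀ᶠ x in 𝓝 xbar, Γ x ⊆ C := by
  obtain ⟨B, hB, U, hU, hUB⟩ := hΓ
  exact ⟨closure B, hB.isCompact_closure,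
    mem_of_superset hU fun x hx => (hUB x hx).trans subset_closure⟩

/-- Under local boundedness, solutions exist for all parameters with nonempty feasible set near
the reference parameter. -/
lemma eventually_solutionMap_nonempty (hf : JointlyC1 f) (hg : ∀ i, JointlyC1 (g i))
    (hh : ∀ j, JointlyC1 (h j)) (hΓ : LocallyBoundedAt (feasibleMap g h) xbar) :
    ∀ᶠ x in 𝓝 xbar, x ∈ dom (feasibleMap g h) →
      (solutionMap f (feasibleMap g h) x).Nonempty := by
  obtain ⟨C, hC, hev⟩ := hΓ.exists_isCompact
  filter_upwards [hev] with x hx hne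
  have hcl : IsClosed (feasibleMap g h x) :=
    (isClosed_graph_feasibleMap hg hh).preimage (Continuous.prodMk_right x)
  obtain ⟨y, hy, hmin⟩ := (hC.of_isClosed_subset hcl hx).exists_isMinOn hne
    (hf.continuous.comp (Continuous.prodMk_right x)).continuousOn
  exact ⟨y, hy, fun z hz => hmin hz⟩

/-- Under the constraint qualification for the value function description of the solution
mapping, the constraint `f(x, y) ≤ ψ(x)` may be added to the feasible set mapping without losing
solvability close to a reference solution. -/
lemma eventually_exists_sublevel_near (hf : JointlyC1 f) (hg : ∀ i, JointlyC1 (g i))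
    (hh : ∀ j, JointlyC1 (h j)) (hA1 : ConvexData f g h)
    (hA2 : LocallyBoundedAt (feasibleMap g h) xbar) {ybar : E m}
    (hy : ybar ∈ solutionMap f (feasibleMap g h) xbar)
    (hCQ : RCPLDSolutionAt f g h (dom (feasibleMap g h)) xbar ybar) {ψ : E n → ℝ}
    (hψ : ContinuousWithinAt ψ (dom (feasibleMap g h)) xbar) (hψy : f xbar ybar ≤ ψ xbar)
    {ε : ℝ} (hε : 0 < ε) :
    ∀ᶠ x in 𝓝[dom (feasibleMap g h)] xbar, (∃ u ∈ feasibleMap g h x, f x u ≤ ψ x) →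
      ∃ y ∈ Metric.ball ybar ε, y ∈ feasibleMap g h x ∧ f x y ≤ ψ x := by
  set Ω := dom (feasibleMap g h) with hΩ
  have hxΩ : xbar ∈ Ω := ⟨ybar, hy.1⟩
  obtain ⟨U, hU, B, ⟨hBI, hBspan⟩, ⟨r, hr⟩, hK⟩ := hCQ
  -- Replacing `φ` by `ψ` leaves the gradients in `y` unchanged, so the qualification condition
  -- carries over.
  let c : Option (Fin ℓ) → E n → E m → ℝ := fun o x y => o.elim (f x y - ψ x) (fun i => g i x y)
  let Gc : Option (Fin ℓ) → E n → E m → E m :=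
    fun o x y => o.elim (gradient (f x) y) (fun i => gradient (g i x) y)
  let Ge : Fin q → E n → E m → E m := fun j x y => gradient (h j x) y
  have hGe : ∀ j, gradY (fun x y => (h j x y : EReal)) = Ge j := fun j => by
    ext1 x; ext1 y; exact gradY_coe _ _ _
  have hsol : ∀ x, (solutionMap f (feasibleMap g h) x).Nonempty → ∀ o y,
      gradY (solutionIneq f g h o) x y = Gc o x y := by
    rintro x ⟨u, hu⟩ (_ | i) y
    · have h1 : (fun y' => (solutionIneq f g h none x y').toReal) = fun y' => f x y' - f x u := by
        ext1 y'
        simp only [solutionIneq]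
        rw [optimalValue_eq_of_mem hu, ← EReal.coe_sub, EReal.toReal_coe]
      rw [gradY, h1]
      simp only [gradient, Gc, Option.elim_none, fderiv_sub_const]
    · exact gradY_coe _ _ _
  have hr' : ∀ x y, (x, y) ∈ U → x ∈ Ω →
      Module.finrank ℝ (Submodule.span ℝ (range fun j => Ge j x y)) = r := fun x y hz hxΩ => by
    have h1 : (fun j => Ge j x y) = fun j => gradY (fun x y => (h j x y : EReal)) x y :=
      funext fun j => (gradY_coe _ _ _).symm
    rw [h1]
    exact hr x y hz hxΩ
  simp only [hGe] at hBI hBspan hK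
  simp only [hsol xbar ⟨ybar, hy⟩] at hK
  have hnear : ∀ᶠ z in 𝓝[Ω] xbar ×ˢ 𝓝 ybar, z ∈ U ∧ z.1 ∈ Ω ∧
      (solutionMap f (feasibleMap g h) z.1).Nonempty := by
    have h1 : ∀ᶠ z in 𝓝[Ω] xbar ×ˢ 𝓝 ybar, z ∈ U := by
      rw [nhds_prod_eq] at hU
      exact (Filter.prod_mono_left _ nhdsWithin_le_nhds) hU
    have h2 : ∀ᶠ z in 𝓝[Ω] xbar ×ˢ 𝓝 ybar, z.1 ∈ Ω :=
      tendsto_fst.eventually self_mem_nhdsWithin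
    have h3 : ∀ᶠ z in 𝓝[Ω] xbar ×ˢ 𝓝 ybar, z.1 ∈ Ω →
        (solutionMap f (feasibleMap g h) z.1).Nonempty :=
      tendsto_fst.eventually
        ((eventually_solutionMap_nonempty hf hg hh hA2).filter_mono nhdsWithin_le_nhds)
    filter_upwards [h1, h2, h3] with z hz1 hz2 hz3
    exact ⟨hz1, hz2, hz3 hz2⟩
  have hspan : ∀ᶠ z in 𝓝[Ω] xbar ×ˢ 𝓝 ybar, ∀ j, Ge j z.1 z.2 ∈
      Submodule.span ℝ (range fun j : B => Ge j z.1 z.2) := by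
    -- The constant rank is the size of `B`, and independence is an open condition, so nearby the
    -- `B`-gradients still span by dimension.
    have hrB : r = B.card := by
      rw [← hr' xbar ybar (mem_of_mem_nhds hU) hxΩ, ← hBspan, finrank_span_eq_card hBI,
        Fintype.card_coe]
    have hcB : Continuous fun z : E n × E m => fun j : B => Ge j z.1 z.2 :=
      continuous_pi fun j => (hh j).continuous_gradient
    have h1 : ∀ᶠ z in 𝓝 (xbar, ybar), LinearIndependent ℝ (fun j : B => Ge j z.1 z.2) :=
      (isOpen_setOfPred_linearIndependent.preimage hcB).mem_nhds hBI
    rw [nhds_prod_eq] at h1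
    filter_upwards [hnear, h1.filter_mono (prod_mono_left _ nhdsWithin_le_nhds)] with z hz hzI j
    have hle : Submodule.span ℝ (range fun j : B => Ge j z.1 z.2) ≤
        Submodule.span ℝ (range fun j => Ge j z.1 z.2) :=
      Submodule.span_mono (by rintro _ ⟨j, rfl⟩; exact ⟨j, rfl⟩)
    rw [Submodule.eq_of_le_of_finrank_eq hle (by
      rw [hr' z.1 z.2 hz.1 hz.2.1, hrB, finrank_span_eq_card hzI, Fintype.card_coe])]
    exact Submodule.subset_span (mem_range_self j)
  have hmem : ∀ x y, ((∀ o, c o x y ≤ 0) ∧ ∀ j, h j x y = 0) ↔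
      y ∈ feasibleMap g h x ∧ f x y ≤ ψ x := fun x y => by
    simp only [Option.forall, c, Option.elim_none, Option.elim_some, feasibleMap, mem_ofPred_eq,
      sub_nonpos]
    tauto
  have key := eventually_exists_feasible_near (c := c) (e := h) (Gc := Gc) (Ge := Ge) (Ω := Ω)
    (xbar := xbar) (ybar := ybar) ?_ (fun j x y => (hh j).hasFDerivAt x y) ?_
    (fun j x y z => inner_gradient_eq_of_affine (hh j) ((hA1 x).2.2 j) y z) ?_
    (fun j => (hh j).continuous_gradient) ?_ ?_ ((hmem _ _).2 ⟨hy.1, hψy⟩) (B := B) hBI hspan ?_ hε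
  · simp only [hmem] at key
    filter_upwards [key] with x hx ⟨u, hu⟩
    exact hx ⟨u, hu⟩
  · rintro (_ | i) x y
    · exact (hf.hasFDerivAt x y).sub_const _
    · exact (hg i).hasFDerivAt x y
  · rintro (_ | i) x y z
    · have := (hA1 x).1.inner_gradient_le (hf.hasFDerivAt x y) z
      simpa [c, Gc] using this
    · exact ((hA1 x).2.1 i).inner_gradient_le ((hg i).hasFDerivAt x y) z
  · rintro (_ | i)
    · exact hf.continuous_gradient
    · exact (hg i).continuous_gradient
  · have hle : ∀ y : E m, 𝓝[Ω] xbar ×ˢ 𝓝 y ≤ 𝓝 (xbar, y) := fun y => by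
      rw [nhds_prod_eq]; exact prod_mono_left _ nhdsWithin_le_nhds
    rintro (_ | i) y
    · exact ((hf.continuous.tendsto (xbar, y)).mono_left (hle y)).sub (hψ.tendsto.comp tendsto_fst)
    · exact ((hg i).continuous.tendsto (xbar, y)).mono_left (hle y)
  · intro j y
    refine ((hh j).continuous.tendsto (xbar, y)).mono_left ?_
    rw [nhds_prod_eq]; exact prod_mono_left _ nhdsWithin_le_nhds
  · intro K hKact hPLD
    -- Index `none` is always active in the value function description, whether or not `f ≤ ψ` is.
    have hact : ∀ i ∈ K, solutionIneq f g h i xbar ybar = 0 := by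
      rintro (_ | i) hi
      · simp only [solutionIneq]
        rw [optimalValue_eq_of_mem hy, ← EReal.coe_sub, sub_self, EReal.coe_zero]
      · exact EReal.coe_eq_zero.2 (hKact _ hi)
    filter_upwards [hnear] with z hz
    have := hK K hact hPLD z.1 z.2 hz.1 hz.2.1
    simpa only [hsol z.1 hz.2.2] using this

/-- Under the constraint qualification, the optimal value function is continuous at the reference
parameter relative to the domain of the feasible set mapping. -/
lemma continuousWithinAt_optimalValue (hf : JointlyC1 f) (hg : ∀ i, JointlyC1 (g i))
    (hh : ∀ j, JointlyC1 (h j)) (hA1 : ConvexData f g h)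
    (hA2 : LocallyBoundedAt (feasibleMap g h) xbar) {ybar : E m}
    (hy : ybar ∈ solutionMap f (feasibleMap g h) xbar)
    (hCQ : RCPLDSolutionAt f g h (dom (feasibleMap g h)) xbar ybar) :
    ContinuousWithinAt (fun x => (optimalValue f (feasibleMap g h) x).toReal)
      (dom (feasibleMap g h)) xbar := by
  obtain ⟨C, hC, hev⟩ := hA2.exists_isCompact
  have hsol : ∀ᶠ x in 𝓝[dom (feasibleMap g h)] xbar,
      (solutionMap f (feasibleMap g h) x).Nonempty := by
    filter_upwards [self_mem_nhdsWithin, (eventually_solutionMap_nonempty hf hg hh hA2).filter_mono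
      nhdsWithin_le_nhds] with x hx hx' using hx' hx
  rw [ContinuousWithinAt, optimalValue_eq_of_mem hy, EReal.toReal_coe, tendsto_order]
  refine ⟨fun a ha => ?_, fun a ha => ?_⟩
  -- Below `φ(xbar)`, the closed graph excludes each point of `C` locally; compactness makes this
  -- uniform.
  · have hlow : ∀ᶠ x in 𝓝 xbar, ∀ y ∈ C, ¬(y ∈ feasibleMap g h x ∧ f x y ≤ a) := by
      refine hC.eventually_forall_of_forall_eventually fun y _ => ?_
      have hcl : IsClosed {z : E n × E m | z.2 ∈ feasibleMap g h z.1 ∧ f z.1 z.2 ≤ a} :=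
        (isClosed_graph_feasibleMap hg hh).inter (isClosed_le hf.continuous continuous_const)
      refine hcl.isOpen_compl.mem_nhds fun hmem => ?_
      have := hy.2 y hmem.1
      exact absurd hmem.2 (not_le.2 (ha.trans_le this))
    filter_upwards [hsol, hlow.filter_mono nhdsWithin_le_nhds,
      hev.filter_mono nhdsWithin_le_nhds] with x ⟨u, hu⟩ hx hxC
    rw [optimalValue_eq_of_mem hu, EReal.toReal_coe]
    exact not_le.1 fun hle => hx u (hxC hu.1) ⟨hu.1, hle⟩
  -- With `ψ = M` the added constraint holds on all of `Γ x`, so points of `Γ x` exist near `ybar`.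
  · obtain ⟨M, hM⟩ : ∃ M, ∀ᶠ x in 𝓝 xbar, ∀ y ∈ feasibleMap g h x, f x y ≤ M := by
      obtain ⟨M, hM⟩ := (((isCompact_closedBall xbar 1).prod hC).image hf.continuous).bddAbove
      refine ⟨M, ?_⟩
      filter_upwards [hev, Metric.closedBall_mem_nhds xbar one_pos] with x hx hxb y hyx
      exact hM ⟨(x, y), ⟨hxb, hx hyx⟩, rfl⟩
    have hupp : ∀ᶠ z in 𝓝 xbar ×ˢ 𝓝 ybar, f z.1 z.2 < a := by
      rw [← nhds_prod_eq]
      exact (hf.continuous.tendsto (xbar, ybar)).eventually_lt_const ha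
    obtain ⟨p, hp, r, hr, hpr⟩ := eventually_prod_iff.1 hupp
    obtain ⟨ε, hε, hball⟩ := Metric.eventually_nhds_iff_ball.1 hr
    filter_upwards [hsol, self_mem_nhdsWithin, hM.filter_mono nhdsWithin_le_nhds,
      hp.filter_mono nhdsWithin_le_nhds, eventually_exists_sublevel_near hf hg hh hA1 hA2 hy hCQ
        (ψ := fun _ => M) continuousWithinAt_const (hM.self_of_nhds _ hy.1) hε]
      with x ⟨u, hu⟩ ⟨v, hv⟩ hxM hpx hx
    obtain ⟨y, hyb, hyx, -⟩ := hx ⟨v, hv, hxM v hv⟩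
    rw [optimalValue_eq_of_mem hu, EReal.toReal_coe]
    exact (hu.2 y hyx).trans_lt (hpr hpx (hball y hyb))

end SolutionMap

end ParamOpt

/-! ### Lower semicontinuity of the solution mapping -/

theorem mainTheorem11 {n m ℓ q : ℕ}
    (f : ParamOpt.E n → ParamOpt.E m → ℝ)
    (g : Fin ℓ → ParamOpt.E n → ParamOpt.E m → ℝ)
    (h : Fin q → ParamOpt.E n → ParamOpt.E m → ℝ)
    (hf : ParamOpt.JointlyC1 f)
    (hg : ∀ i, ParamOpt.JointlyC1 (g i))
    (hh : ∀ j, ParamOpt.JointlyC1 (h j))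
    (xbar : ParamOpt.E n)
    (hx : xbar ∈ ParamOpt.dom (ParamOpt.feasibleMap g h))
    (hA1 : ParamOpt.ConvexData f g h)
    (hA2 : ParamOpt.LocallyBoundedAt (ParamOpt.feasibleMap g h) xbar)
    (hRCPLD : ∀ ybar ∈ ParamOpt.solutionMap f (ParamOpt.feasibleMap g h) xbar,
      ParamOpt.RCPLDSolutionAt f g h (ParamOpt.dom (ParamOpt.feasibleMap g h)) xbar ybar) :
    LowerHemicontinuousWithinAt
      (ParamOpt.solutionMap f (ParamOpt.feasibleMap g h))
      (ParamOpt.dom (ParamOpt.solutionMap f (ParamOpt.feasibleMap g h))) xbar := by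
  rw [lowerHemicontinuousWithinAt_iff]
  rintro O hO ⟨ybar, hy, hyO⟩
  obtain ⟨ε, hε, hball⟩ := Metric.isOpen_iff.1 hO ybar hyO
  have hsub : ParamOpt.dom (ParamOpt.solutionMap f (ParamOpt.feasibleMap g h)) ⊆
      ParamOpt.dom (ParamOpt.feasibleMap g h) := fun x ⟨u, hu⟩ => ⟨u, hu.1⟩
  -- With `ψ = φ`, the sublevel system describes exactly `S x` wherever `S x` is nonempty.
  have hnear := ParamOpt.eventually_exists_sublevel_near hf hg hh hA1 hA2 hy (hRCPLD ybar hy)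
    (ParamOpt.continuousWithinAt_optimalValue hf hg hh hA1 hA2 hy (hRCPLD ybar hy))
    (by rw [ParamOpt.optimalValue_eq_of_mem hy, EReal.toReal_coe]) hε
  filter_upwards [hnear.filter_mono (nhdsWithin_mono _ hsub), self_mem_nhdsWithin]
    with x hx ⟨u, hu⟩
  rw [ParamOpt.optimalValue_eq_of_mem hu, EReal.toReal_coe] at hx
  obtain ⟨y, hyb, hyx, hle⟩ := hx ⟨u, hu.1, le_rfl⟩
  exact ⟨y, ⟨hyx, fun z hz => hle.trans (hu.2 z hz)⟩, hball hyb⟩
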